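/- All graphs are finite and simple. A polyhedron is a planar, $3$-connected graph (a graph is $3$-connected if it has at least $4$ vertices and remains connected after the removal of any set of at most $2$ vertices). For a graph $G$ let \[A(G)=\{\,|N(u)\cap N(v)| : u,v\in V(G),\ u\neq v\,\},\] where $N(u)$ denotes the set of neighbours of $u$. Proposition. For every finite non-empty set $A'_3$ of integers $\geq 3$, there are infinitely many pairwise non-isomorphic polyhedra $G$ satisfying \[A(G)=\{0,1,2\}\cup A'_3.\] -/

import Mathlib

namespace SimpleGraph

/-- The Euclidean plane. -/
abbrev Plane : Type := EuclideanSpace ℝ (Fin 2)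

/-- `s` is a simple arc in the plane with end points `a` and `b`: the image of an injective
continuous path from `a` to `b`. -/
def IsSimpleArc (s : Set Plane) (a b : Plane) : Prop :=
  ∃ γ : _root_.Path a b, Function.Injective γ ∧ Set.range γ = s

/-- An embedding of a graph in the plane: distinct vertices are distinct points, every edge is a
simple arc that joins its two end vertices and passes through no other vertex, and two different
edges meet only at vertices. The value of `arc` off the edge set is irrelevant. -/
structure PlaneEmbedding {V : Type*} (G : SimpleGraph V) where
  pos : V → Plane
  pos_injective : Function.Injective pos
  arc : Sym2 V → Set Plane
  arc_isSimpleArc : ∀ u v : V, G.Adj u v → IsSimpleArc (arc s(u, v)) (pos u) (pos v)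
  mem_of_pos_mem_arc : ∀ e ∈ G.edgeSet, ∀ w : V, pos w ∈ arc e → w ∈ e
  arc_inter_arc : ∀ e ∈ G.edgeSet, ∀ f ∈ G.edgeSet, e ≠ f → arc e ∩ arc f ⊆ Set.range pos

/-- A graph is planar if it can be embedded in the plane. -/
def IsPlanar {V : Type*} (G : SimpleGraph V) : Prop :=
  Nonempty (PlaneEmbedding G)

/-- A finite graph is `k`-connected if it has at least `k + 1` vertices and it remains connected
whenever fewer than `k` vertices are removed. -/
def IsVertexConnected {V : Type*} [Fintype V] (k : ℕ) (G : SimpleGraph V) : Prop :=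
  k + 1 ≤ Fintype.card V ∧
    ∀ S : Finset V, S.card < k → (G.induce {v : V | v ∉ S}).Connected

/-- A polyhedron is a (finite) planar, `3`-connected graph. -/
def IsPolyhedron {V : Type*} [Fintype V] (G : SimpleGraph V) : Prop :=
  G.IsPlanar ∧ G.IsVertexConnected 3

/-- The type `A(G)` of a graph: the set of the numbers of common neighbours of all pairs of
distinct vertices. -/
def commonNeighborType {V : Type*} (G : SimpleGraph V) : Set ℕ :=
  {a : ℕ | ∃ u v : V, u ≠ v ∧ (G.commonNeighbors u v).ncard = a}

end SimpleGraph

/-!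
Fix a composition of `n` into blocks of size at least `3`. Take an apex, a path of hubs, one for
each block, and a rim path with one triple of vertices for every `i < n` (the two outermost vertices
are omitted). In each triple the middle vertex is joined to both the apex and the hub of the block
of `i`, the first one only to this hub, and the last one only to the apex. The apex and a hub thus
have as many common neighbours as the block has elements, while any other two vertices have at most
two.

The graph is planar: with hubs, rim and apex in three successive rows, all edges are segments
between neighbouring points of a row or between successive rows, and since blocks are intervals the
latter do not cross. For `3`-connectivity, the apex still reaches every hub after the removal of two
other vertices, as they have at least three common neighbours; once the apex is removed, either the
rim path or the hub path is left intact. Repeating a block yields infinitely many orders without new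
values.
-/

open SimpleGraph Relation

theorem isSimpleArc_segment {a b : Plane} (h : a ≠ b) : IsSimpleArc (segment ℝ a b) a b := by
  refine ⟨⟨⟨fun t => AffineMap.lineMap a b (t : ℝ), by
    simp only [AffineMap.lineMap_apply_module]; fun_prop⟩, by simp, by simp⟩, ?_, ?_⟩
  · exact (AffineMap.lineMap_injective ℝ h).comp Subtype.val_injective
  · rw [segment_eq_image_lineMap, Set.image_eq_range]
    rfl

section OpenSegment

variable {ι : Type*} {a b p : EuclideanSpace ℝ ι}

theorem apply_mem_openSegment (hp : p ∈ openSegment ℝ a b) (i : ι) :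
    p i ∈ openSegment ℝ (a i) (b i) := by
  obtain ⟨s, t, hs, ht, hst, rfl⟩ := hp
  exact ⟨s, t, hs, ht, hst, by simp⟩

theorem apply_eq_of_mem_openSegment (hp : p ∈ openSegment ℝ a b) {i : ι} (h : a i = b i) :
    p i = a i := by
  simpa only [← h, openSegment_same, Set.mem_singleton_iff] using apply_mem_openSegment hp i

theorem apply_mem_Ioo_of_mem_openSegment (hp : p ∈ openSegment ℝ a b) {i : ι} (h : a i < b i) :
    p i ∈ Set.Ioo (a i) (b i) :=
  openSegment_subset_Ioo h (apply_mem_openSegment hp i)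

theorem eq_and_eq_of_mem_openSegment {a b a' b' p : Plane} (hp : p ∈ openSegment ℝ a b)
    (hp' : p ∈ openSegment ℝ a' b') (hab : a 1 < b 1) (ha : a 1 = a' 1) (hb : b 1 = b' 1)
    (hle : a 0 ≤ a' 0) (hle' : b 0 ≤ b' 0) : a = a' ∧ b = b' := by
  obtain ⟨s, t, hs, ht, hst, rfl⟩ := hp
  -- The height of a common point determines its parameter on both segments, and at a given interior
  -- parameter the abscissa is a strictly increasing function of those of the end points.
  obtain ⟨s', t', -, -, hst', heq⟩ := hp'
  have height : s' * a' 1 + t' * b' 1 = s * a 1 + t * b 1 := by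
    simpa using congrArg (fun q : Plane => q 1) heq
  have abscissa : s' * a' 0 + t' * b' 0 = s * a 0 + t * b 0 := by
    simpa using congrArg (fun q : Plane => q 0) heq
  have parameter : t' = t := by
    obtain rfl := eq_sub_of_add_eq hst
    obtain rfl := eq_sub_of_add_eq hst'
    rw [← ha, ← hb] at height
    have : (t' - t) * (b 1 - a 1) = 0 := by linear_combination height
    exact sub_eq_zero.1 ((mul_eq_zero.1 this).resolve_right (sub_pos.2 hab).ne')
  obtain rfl : s' = s := by linarith
  subst parameter
  have ha₀ : a 0 = a' 0 := by nlinarith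
  have hb₀ : b 0 = b' 0 := by nlinarith
  constructor <;> ext i <;> fin_cases i <;> assumption

end OpenSegment

/-- The point of the plane with the given integer coordinates. -/
noncomputable def gridPoint (p : ℤ × ℤ) : Plane := !₂[(p.1 : ℝ), (p.2 : ℝ)]

@[simp] theorem gridPoint_zero (p : ℤ × ℤ) : gridPoint p 0 = p.1 := rfl

@[simp] theorem gridPoint_one (p : ℤ × ℤ) : gridPoint p 1 = p.2 := rfl

theorem gridPoint_injective : Function.Injective gridPoint := fun p q h => by
  have h₀ := congrArg (fun x : Plane => x 0) h
  have h₁ := congrArg (fun x : Plane => x 1) h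
  exact Prod.ext (by simpa using h₀) (by simpa using h₁)

theorem eq_of_mem_Ioo_add_one {x : ℝ} {m n : ℤ} (hm : x ∈ Set.Ioo (m : ℝ) (m + 1))
    (hn : x ∈ Set.Ioo (n : ℝ) (n + 1)) : m = n :=
  (Int.floor_eq_iff.2 ⟨hm.1.le, hm.2⟩).symm.trans (Int.floor_eq_iff.2 ⟨hn.1.le, hn.2⟩)

theorem intCast_notMem_Ioo_add_one (k m : ℤ) : (k : ℝ) ∉ Set.Ioo (m : ℝ) (m + 1) := by
  rintro ⟨h, h'⟩
  norm_cast at h h'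
  omega

/-- A step in the integer grid: to the next point of the same row, or to any point of the next row.
Every edge of a layered drawing is a step in one of its two directions. -/
inductive IsStep (p : ℤ × ℤ) : ℤ × ℤ → Prop
  | right : IsStep p (p.1 + 1, p.2)
  | up (x : ℤ) : IsStep p (x, p.2 + 1)

namespace IsStep

variable {p q p' q' : ℤ × ℤ} {x : Plane}

theorem zero_mem_Ioo_of_right (hx : x ∈ openSegment ℝ (gridPoint p) (gridPoint (p.1 + 1, p.2))) :
    x 0 ∈ Set.Ioo (p.1 : ℝ) (p.1 + 1) := by
  simpa using apply_mem_Ioo_of_mem_openSegment hx (i := 0) (by simp)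

theorem one_eq_of_right (hx : x ∈ openSegment ℝ (gridPoint p) (gridPoint (p.1 + 1, p.2))) :
    x 1 = p.2 :=
  apply_eq_of_mem_openSegment hx rfl

theorem one_mem_Ioo_of_up {k : ℤ}
    (hx : x ∈ openSegment ℝ (gridPoint p) (gridPoint (k, p.2 + 1))) :
    x 1 ∈ Set.Ioo (p.2 : ℝ) (p.2 + 1) := by
  simpa using apply_mem_Ioo_of_mem_openSegment hx (i := 1) (by simp)

theorem gridPoint_notMem_openSegment (h : IsStep p q) (r : ℤ × ℤ) :
    gridPoint r ∉ openSegment ℝ (gridPoint p) (gridPoint q) := fun hr => by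
  cases h with
  | right => exact intCast_notMem_Ioo_add_one _ _ (zero_mem_Ioo_of_right hr)
  | up => exact intCast_notMem_Ioo_add_one _ _ (one_mem_Ioo_of_up hr)

theorem eq_and_eq_of_mem_openSegment (h : IsStep p q) (h' : IsStep p' q')
    (hx : x ∈ openSegment ℝ (gridPoint p) (gridPoint q))
    (hx' : x ∈ openSegment ℝ (gridPoint p') (gridPoint q'))
    (noncrossing : p.2 = p'.2 → p.2 < q.2 → p'.2 < q'.2 →
      p.1 ≤ p'.1 ∧ q.1 ≤ q'.1 ∨ p'.1 ≤ p.1 ∧ q'.1 ≤ q.1) :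
    p = p' ∧ q = q' := by
  cases h with
  | right =>
    have hrow := one_eq_of_right hx
    cases h' with
    | right =>
      obtain rfl : p = p' := Prod.ext
        (eq_of_mem_Ioo_add_one (zero_mem_Ioo_of_right hx) (zero_mem_Ioo_of_right hx'))
        (Int.cast_injective (hrow.symm.trans (one_eq_of_right hx')))
      exact ⟨rfl, rfl⟩
    | up => exact absurd (hrow ▸ one_mem_Ioo_of_up hx') (intCast_notMem_Ioo_add_one _ _)
  | up k =>
    cases h' with
    | right =>
      exact absurd (one_eq_of_right hx' ▸ one_mem_Ioo_of_up hx) (intCast_notMem_Ioo_add_one _ _)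
    | up k' =>
      have hrow : p.2 = p'.2 :=
        eq_of_mem_Ioo_add_one (one_mem_Ioo_of_up hx) (one_mem_Ioo_of_up hx')
      rw [← gridPoint_injective.eq_iff, ← gridPoint_injective.eq_iff (b := (k', _))]
      rcases noncrossing hrow (by simp) (by simp) with ⟨hp, hq⟩ | ⟨hp, hq⟩
      · exact _root_.eq_and_eq_of_mem_openSegment hx hx' (by simp) (by simp [hrow])
          (by simp [hrow]) (by simpa using hp) (by simpa using hq)
      · exact (_root_.eq_and_eq_of_mem_openSegment hx' hx (by simp) (by simp [hrow])
          (by simp [hrow]) (by simpa using hp) (by simpa using hq)).imp Eq.symm Eq.symm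

end IsStep

/-- A placement of the vertices of a graph at distinct points of the integer grid such that the
edges, drawn as straight segments, do not cross: every edge is a step, in one of its directions, and
the steps between two successive rows are weakly ordered from left to right. -/
structure LayeredDrawing {V : Type*} (G : SimpleGraph V) where
  coord : V → ℤ × ℤ
  coord_injective : Function.Injective coord
  isStep_or_isStep : ∀ u v, G.Adj u v → IsStep (coord u) (coord v) ∨ IsStep (coord v) (coord u)
  noncrossing : ∀ u v u' v', G.Adj u v → G.Adj u' v' → (coord u).2 = (coord u').2 →
    (coord u).2 < (coord v).2 → (coord u').2 < (coord v').2 → (coord u).1 < (coord u').1 →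
    (coord v).1 ≤ (coord v').1

namespace LayeredDrawing

variable {V : Type*} {G : SimpleGraph V} (D : LayeredDrawing G)

/-- The position of a vertex of a layered drawing in the plane. -/
noncomputable def pos (v : V) : Plane := gridPoint (D.coord v)

/-- The segment that represents an edge of a layered drawing. -/
noncomputable def arc : Sym2 V → Set Plane :=
  Sym2.lift ⟨fun u v => segment ℝ (D.pos u) (D.pos v), fun _ _ => segment_symm ℝ _ _⟩

theorem pos_injective : Function.Injective D.pos :=
  gridPoint_injective.comp D.coord_injective

theorem arc_mk (u v : V) :
    D.arc s(u, v) = insert (D.pos u) (insert (D.pos v) (openSegment ℝ (D.pos u) (D.pos v))) :=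
  (insert_endpoints_openSegment ℝ _ _).symm

theorem exists_isStep {e : Sym2 V} (he : e ∈ G.edgeSet) :
    ∃ u v, e = s(u, v) ∧ G.Adj u v ∧ IsStep (D.coord u) (D.coord v) := by
  induction e with
  | _ u v =>
    rcases D.isStep_or_isStep u v he with h | h
    · exact ⟨u, v, rfl, he, h⟩
    · exact ⟨v, u, Sym2.eq_swap, SimpleGraph.Adj.symm he, h⟩

theorem mem_of_pos_mem_arc {e : Sym2 V} (he : e ∈ G.edgeSet) {w : V} (hw : D.pos w ∈ D.arc e) :
    w ∈ e := by
  obtain ⟨u, v, rfl, -, hstep⟩ := D.exists_isStep he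
  rw [arc_mk] at hw
  rcases hw with hu | hv | h
  · exact Sym2.mem_iff.2 (.inl (D.pos_injective hu))
  · exact Sym2.mem_iff.2 (.inr (D.pos_injective hv))
  · exact absurd h (hstep.gridPoint_notMem_openSegment _)

theorem noncrossing_of_row_eq {u v u' v' : V} (h : G.Adj u v) (h' : G.Adj u' v')
    (hrow : (D.coord u).2 = (D.coord u').2) (hup : (D.coord u).2 < (D.coord v).2)
    (hup' : (D.coord u').2 < (D.coord v').2) :
    (D.coord u).1 ≤ (D.coord u').1 ∧ (D.coord v).1 ≤ (D.coord v').1 ∨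
      (D.coord u').1 ≤ (D.coord u).1 ∧ (D.coord v').1 ≤ (D.coord v).1 := by
  rcases lt_trichotomy (D.coord u).1 (D.coord u').1 with hlt | heq | hgt
  · exact .inl ⟨hlt.le, D.noncrossing u v u' v' h h' hrow hup hup' hlt⟩
  · exact (le_total _ _).imp (⟨heq.le, ·⟩) (⟨heq.ge, ·⟩)
  · exact .inr ⟨hgt.le, D.noncrossing u' v' u v h' h hrow.symm hup' hup hgt⟩

theorem arc_inter_arc {e f : Sym2 V} (he : e ∈ G.edgeSet) (hf : f ∈ G.edgeSet) (hef : e ≠ f) :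
    D.arc e ∩ D.arc f ⊆ Set.range D.pos := by
  obtain ⟨u, v, rfl, huv, hstep⟩ := D.exists_isStep he
  obtain ⟨u', v', rfl, huv', hstep'⟩ := D.exists_isStep hf
  rintro x ⟨hx, hx'⟩
  rw [arc_mk] at hx hx'
  rcases hx with rfl | rfl | hx
  · exact ⟨u, rfl⟩
  · exact ⟨v, rfl⟩
  rcases hx' with rfl | rfl | hx'
  · exact ⟨u', rfl⟩
  · exact ⟨v', rfl⟩
  obtain ⟨hu, hv⟩ := hstep.eq_and_eq_of_mem_openSegment hstep' hx hx'
    (D.noncrossing_of_row_eq huv huv')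
  exact absurd (by rw [D.coord_injective hu, D.coord_injective hv]) hef

theorem isPlanar (D : LayeredDrawing G) : G.IsPlanar :=
  ⟨{ pos := D.pos
     pos_injective := D.pos_injective
     arc := D.arc
     arc_isSimpleArc := fun _ _ h => isSimpleArc_segment (D.pos_injective.ne h.ne)
     mem_of_pos_mem_arc := fun _ he _ hw => D.mem_of_pos_mem_arc he hw
     arc_inter_arc := fun _ he _ hf hef => D.arc_inter_arc he hf hef }⟩

end LayeredDrawing

section Transport

variable {V W : Type*} {G : SimpleGraph V} {H : SimpleGraph W}

theorem isPlanar_of_isContained (h : H ⊑ G) (hG : G.IsPlanar) : H.IsPlanar := by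
  obtain ⟨E⟩ := hG
  obtain ⟨f⟩ := h
  have mem_edgeSet : ∀ e ∈ H.edgeSet, e.map f ∈ G.edgeSet := fun e => f.toHom.map_mem_edgeSet
  refine ⟨{
    pos := E.pos ∘ f
    pos_injective := E.pos_injective.comp f.injective
    arc := fun e => E.arc (e.map f)
    arc_isSimpleArc := fun u v h => E.arc_isSimpleArc _ _ (f.toHom.map_adj h)
    mem_of_pos_mem_arc := fun e he w hw => ?_
    arc_inter_arc := fun e he e' he' hne => ?_ }⟩
  · obtain ⟨x, hx, hxw⟩ := Sym2.mem_map.1 (E.mem_of_pos_mem_arc _ (mem_edgeSet e he) _ hw)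
    rwa [f.injective hxw] at hx
  · rintro p ⟨hp, hp'⟩
    obtain ⟨v, rfl⟩ := E.arc_inter_arc _ (mem_edgeSet e he) _ (mem_edgeSet e' he')
      (fun h => hne (Sym2.map.injective f.injective h)) ⟨hp, hp'⟩
    obtain ⟨w, -, rfl⟩ := Sym2.mem_map.1 (E.mem_of_pos_mem_arc _ (mem_edgeSet e he) _ hp)
    exact ⟨w, rfl⟩

theorem isVertexConnected_of_bijective [Fintype V] [Fintype W] {k : ℕ} (f : G →g H)
    (hf : Function.Bijective f) (h : G.IsVertexConnected k) : H.IsVertexConnected k := by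
  refine ⟨(Fintype.card_of_bijective hf) ▸ h.1, fun S hS => ?_⟩
  have hcard : (S.preimage f hf.injective.injOn).card < k :=
    (Finset.card_le_card_of_injOn f (fun _ => Finset.mem_preimage.1) hf.injective.injOn).trans_lt hS
  have hmaps : Set.MapsTo f {v | v ∉ S.preimage f hf.injective.injOn} {w | w ∉ S} :=
    fun _ hv hw => hv (Finset.mem_preimage.2 hw)
  refine (h.2 _ hcard).map (induceHom f hmaps) ?_
  rintro ⟨w, hw⟩
  obtain ⟨v, rfl⟩ := hf.surjective w
  exact ⟨⟨v, fun hv => hw (Finset.mem_preimage.1 hv)⟩, rfl⟩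

theorem isPolyhedron_of_iso [Fintype V] [Fintype W] (φ : G ≃g H) (h : G.IsPolyhedron) :
    H.IsPolyhedron :=
  ⟨isPlanar_of_isContained φ.isContained' h.1,
    isVertexConnected_of_bijective φ.toHom φ.bijective h.2⟩

theorem image_commonNeighbors_of_iso (φ : G ≃g H) (u v : V) :
    φ '' G.commonNeighbors u v = H.commonNeighbors (φ u) (φ v) := by
  ext w
  obtain ⟨x, rfl⟩ := φ.surjective w
  simp only [φ.injective.mem_set_image, mem_commonNeighbors, φ.map_adj_iff]

theorem commonNeighborType_eq_of_iso (φ : G ≃g H) :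
    G.commonNeighborType = H.commonNeighborType := by
  ext a
  simp only [commonNeighborType, Set.mem_ofPred_eq, φ.surjective.exists, φ.injective.ne_iff,
    ← image_commonNeighbors_of_iso, Set.ncard_image_of_injective _ φ.injective]

end Transport

theorem ncard_le_two_of_injective {α β : Type*} {f : α → β} (hf : Function.Injective f) {s : Set α}
    (p q : β) (h : ∀ x ∈ s, f x = p ∨ f x = q) : s.ncard ≤ 2 := by
  have himage : f '' s ⊆ {p, q} := Set.image_subset_iff.2 h
  rw [← Set.ncard_image_of_injective s hf]
  exact (Set.ncard_le_ncard himage).trans ((Set.ncard_insert_le p {q}).trans (by simp))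

theorem exists_notMem_of_card_lt_three {α : Type*} {S : Finset α} (hS : S.card < 3) {x y z : α}
    (hxy : x ≠ y) (hxz : x ≠ z) (hyz : y ≠ z) : x ∉ S ∨ y ∉ S ∨ z ∉ S := by
  classical
  by_contra! h
  have hsub : ({x, y, z} : Finset α) ⊆ S := by simp [Finset.insert_subset_iff, h]
  have hcard := Finset.card_le_card hsub
  rw [Finset.card_eq_three.2 ⟨x, y, z, hxy, hxz, hyz, rfl⟩] at hcard
  omega

/-- Reachability along a walk all of whose vertices after the first one lie in `s`. In contrast to
reachability in the induced subgraph on `s`, it relates vertices of the whole graph. -/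
def ReachableWithin {V : Type*} (G : SimpleGraph V) (s : Set V) : V → V → Prop :=
  ReflTransGen fun u v => G.Adj u v ∧ v ∈ s

namespace ReachableWithin

variable {V : Type*} {G : SimpleGraph V} {s : Set V} {r u v : V}

theorem refl (r : V) : ReachableWithin G s r r := ReflTransGen.refl

theorem step (h : ReachableWithin G s r u) (huv : G.Adj u v) (hv : v ∈ s) :
    ReachableWithin G s r v :=
  ReflTransGen.tail h ⟨huv, hv⟩

theorem of_forall_adj_succ {N : ℕ} {f : Fin N → V}
    (hadj : ∀ i j : Fin N, i.val + 1 = j.val → G.Adj (f i) (f j)) (hf : ∀ i, f i ∈ s)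
    {i j : Fin N} (hij : i ≤ j) : ReachableWithin G s (f i) (f j) := by
  obtain ⟨j, hj⟩ := j
  replace hij : i.val ≤ j := hij
  induction j, hij using Nat.le_induction with
  | base => exact refl _
  | succ k _ ih => exact (ih (by omega)).step (hadj _ _ rfl) (hf _)

theorem exists_reachable_induce (hr : r ∈ s) (h : ReachableWithin G s r v) :
    ∃ hv : v ∈ s, (G.induce s).Reachable ⟨r, hr⟩ ⟨v, hv⟩ := by
  induction h with
  | refl => exact ⟨hr, .refl _⟩
  | tail _ huv ih =>
    obtain ⟨hu, hru⟩ := ih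
    have hadj : (G.induce s).Adj ⟨_, hu⟩ ⟨_, huv.2⟩ := huv.1
    exact ⟨huv.2, hru.trans hadj.reachable⟩

theorem induce_connected (hr : r ∈ s) (h : ∀ v ∈ s, ReachableWithin G s r v) :
    (G.induce s).Connected := by
  rw [connected_iff_exists_forall_reachable]
  exact ⟨⟨r, hr⟩, fun v => (exists_reachable_induce hr (h v v.2)).2⟩

end ReachableWithin

section Composition

variable {n : ℕ} (c : Composition n)

theorem monotone_composition_index : Monotone c.index := fun i j hij => by
  by_contra! hlt
  refine hij.not_gt (Fin.lt_def.2 ?_)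
  calc (j : ℕ) < c.sizeUpTo (c.index j).succ := c.lt_sizeUpTo_index_succ j
    _ ≤ c.sizeUpTo (c.index i) := c.monotone_sizeUpTo (Nat.succ_le_of_lt hlt)
    _ ≤ i := c.sizeUpTo_index_le i

theorem ncard_setOf_composition_index_eq (j : Fin c.length) :
    {i | c.index i = j}.ncard = c.blocksFun j := by
  have hrange : {i | c.index i = j} = Set.range (c.embedding j) :=
    Set.ext fun i => eq_comm.trans c.mem_range_embedding_iff'.symm
  rw [hrange, ← Set.image_univ, Set.ncard_image_of_injective _ (c.embedding j).injective,
    Set.ncard_univ, Nat.card_fin]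

end Composition

/-- The vertices of the block graph of a composition `c` of `n`: an apex, a path of `3 * n - 2` rim
vertices and a path of hubs, one for each block of `c`. The rim vertices are thought of as `n`
successive triples `3 * i - 1, 3 * i, 3 * i + 1`, from which the first and the last one are
missing. -/
inductive BlockVertex {n : ℕ} (c : Composition n) : Type
  | apex : BlockVertex c
  | rim (t : Fin (3 * n - 2)) : BlockVertex c
  | hub (j : Fin c.length) : BlockVertex c

namespace BlockVertex

variable {n : ℕ} {c : Composition n}

/-- The block vertices as a sum type, used for counting them. -/
def equivSum : BlockVertex c ≃ Unit ⊕ Fin (3 * n - 2) ⊕ Fin c.length where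
  toFun
    | apex => .inl ()
    | rim t => .inr (.inl t)
    | hub j => .inr (.inr j)
  invFun
    | .inl _ => apex
    | .inr (.inl t) => rim t
    | .inr (.inr j) => hub j
  left_inv v := by cases v <;> rfl
  right_inv v := by rcases v with _ | _ | _ <;> rfl

instance : Fintype (BlockVertex c) := Fintype.ofEquiv _ equivSum.symm

theorem card_eq : Fintype.card (BlockVertex c) = 1 + (3 * n - 2 + c.length) := by
  simp [Fintype.card_congr (equivSum (c := c))]

/-- The hub at the triple of a rim vertex, whether or not the two are adjacent. -/
def hubOf (c : Composition n) (t : Fin (3 * n - 2)) : Fin c.length :=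
  c.index ⟨(t + 1) / 3, by omega⟩

theorem hubOf_monotone : Monotone (hubOf c) := fun s t hst =>
  monotone_composition_index c (Fin.mk_le_mk.2 (by have := Fin.le_def.1 hst; omega))

/-- Column and row of a vertex in a drawing with the hubs in row `0`, the rim in row `1` and the
apex in row `2`. -/
def coord : BlockVertex c → ℤ × ℤ
  | apex => (0, 2)
  | rim t => (t.val, 1)
  | hub j => (j.val, 0)

theorem coord_injective : Function.Injective (coord (c := c)) := by
  rintro (_ | s | i) (_ | t | j) h <;> simp_all [coord, Fin.ext_iff]

end BlockVertex

open BlockVertex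

/-- The block graph of a composition `c`: of every three successive rim vertices
`3 * i - 1, 3 * i, 3 * i + 1` the latter two are joined to the apex and the former two to the hub of
the block that contains `i`. The common neighbours of the apex and a hub are then the rim vertices
`3 * i` for `i` in the block. -/
def blockGraph {n : ℕ} (c : Composition n) : SimpleGraph (BlockVertex c) where
  Adj
    | apex, rim t | rim t, apex => t.val % 3 ≠ 2
    | rim s, rim t => s.val + 1 = t.val ∨ t.val + 1 = s.val
    | rim t, hub j | hub j, rim t => t.val % 3 ≠ 1 ∧ hubOf c t = j
    | hub i, hub j => i.val + 1 = j.val ∨ j.val + 1 = i.val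
    | apex, apex | apex, hub _ | hub _, apex => False
  symm := ⟨by rintro (_ | s | i) (_ | t | j) h <;> first | exact h | exact h.symm⟩
  loopless := ⟨by rintro (_ | t | j) h <;> simp at h⟩

namespace blockGraph

variable {n : ℕ} {c : Composition n}

@[simp] theorem not_adj_apex_apex : ¬ (blockGraph c).Adj apex apex := id

@[simp] theorem not_adj_apex_hub (j : Fin c.length) : ¬ (blockGraph c).Adj apex (hub j) := id

@[simp] theorem not_adj_hub_apex (j : Fin c.length) : ¬ (blockGraph c).Adj (hub j) apex := id

@[simp] theorem adj_apex_rim (t : Fin (3 * n - 2)) :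
    (blockGraph c).Adj apex (rim t) ↔ t.val % 3 ≠ 2 := Iff.rfl

@[simp] theorem adj_rim_apex (t : Fin (3 * n - 2)) :
    (blockGraph c).Adj (rim t) apex ↔ t.val % 3 ≠ 2 := Iff.rfl

@[simp] theorem adj_rim_rim (s t : Fin (3 * n - 2)) :
    (blockGraph c).Adj (rim s) (rim t) ↔ s.val + 1 = t.val ∨ t.val + 1 = s.val := Iff.rfl

@[simp] theorem adj_rim_hub (t : Fin (3 * n - 2)) (j : Fin c.length) :
    (blockGraph c).Adj (rim t) (hub j) ↔ t.val % 3 ≠ 1 ∧ hubOf c t = j := Iff.rfl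

@[simp] theorem adj_hub_rim (t : Fin (3 * n - 2)) (j : Fin c.length) :
    (blockGraph c).Adj (hub j) (rim t) ↔ t.val % 3 ≠ 1 ∧ hubOf c t = j := Iff.rfl

@[simp] theorem adj_hub_hub (i j : Fin c.length) :
    (blockGraph c).Adj (hub i) (hub j) ↔ i.val + 1 = j.val ∨ j.val + 1 = i.val := Iff.rfl

theorem isStep_or_isStep {u v : BlockVertex c} (h : (blockGraph c).Adj u v) :
    IsStep u.coord v.coord ∨ IsStep v.coord u.coord := by
  rcases u with _ | s | i <;> rcases v with _ | t | j
  case apex.rim | rim.hub => exact .inr (.up _)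
  case rim.apex | hub.rim => exact .inl (.up _)
  case rim.rim | hub.hub =>
    refine h.imp (fun h => ?_) (fun h => ?_) <;> simp only [coord, ← h] <;> exact .right
  all_goals simp at h

theorem eq_rim_apex_or_eq_hub_rim_of_row_lt {u v : BlockVertex c} (h : (blockGraph c).Adj u v)
    (hrow : u.coord.2 < v.coord.2) :
    (∃ t, u = rim t ∧ v = apex) ∨ ∃ t, u = hub (hubOf c t) ∧ v = rim t := by
  rcases u with _ | s | i <;> rcases v with _ | t | j
  case rim.apex => exact .inl ⟨s, rfl, rfl⟩
  case hub.rim => exact .inr ⟨t, congrArg hub h.2.symm, rfl⟩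
  case hub.apex => exact absurd h (not_adj_hub_apex i)
  all_goals simp [coord] at hrow

/-- Since `hubOf` is monotone, the edges between the hubs and the rim do not cross. -/
def layeredDrawing (c : Composition n) : LayeredDrawing (blockGraph c) where
  coord := coord
  coord_injective := coord_injective
  isStep_or_isStep _ _ := isStep_or_isStep
  noncrossing u v u' v' h h' hrow hup hup' hcol := by
    rcases eq_rim_apex_or_eq_hub_rim_of_row_lt h hup with ⟨s, rfl, rfl⟩ | ⟨s, rfl, rfl⟩ <;>
      rcases eq_rim_apex_or_eq_hub_rim_of_row_lt h' hup' with ⟨t, rfl, rfl⟩ | ⟨t, rfl, rfl⟩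
    · exact le_rfl
    · simp [coord] at hrow
    · simp [coord] at hrow
    · simp only [coord, Nat.cast_lt, Nat.cast_le, Fin.val_fin_lt, Fin.val_fin_le] at hcol ⊢
      exact (hubOf_monotone.reflect_lt hcol).le

theorem commonNeighbors_apex_hub (j : Fin c.length) :
    (blockGraph c).commonNeighbors apex (hub j) =
      (fun i : Fin n => rim ⟨3 * i, by omega⟩) '' {i | c.index i = j} := by
  ext w
  rcases w with _ | t | k
  case apex | hub => simp [mem_commonNeighbors]
  simp only [mem_commonNeighbors, adj_apex_rim, adj_hub_rim, Set.mem_image, Set.mem_ofPred_eq,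
    rim.injEq]
  constructor
  · rintro ⟨hapex, hhub, hj⟩
    exact ⟨⟨(t + 1) / 3, by omega⟩, hj, Fin.ext (by dsimp only; omega)⟩
  · rintro ⟨i, hi, rfl⟩
    refine ⟨by simp, by simp, ?_⟩
    rw [← hi, hubOf]
    congr 1
    ext
    dsimp only
    omega

theorem ncard_commonNeighbors_apex_hub (j : Fin c.length) :
    ((blockGraph c).commonNeighbors apex (hub j)).ncard = c.blocksFun j := by
  rw [commonNeighbors_apex_hub, Set.ncard_image_of_injective, ncard_setOf_composition_index_eq]
  intro i k h
  simp only [rim.injEq, Fin.mk.injEq] at h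
  omega

theorem ncard_commonNeighbors_apex_rim_le (t : Fin (3 * n - 2)) :
    ((blockGraph c).commonNeighbors apex (rim t)).ncard ≤ 2 := by
  refine ncard_le_two_of_injective coord_injective ((t : ℤ) - 1, 1) ((t : ℤ) + 1, 1) ?_
  rintro (_ | r | k) h <;> simp only [mem_commonNeighbors, not_adj_apex_apex, not_adj_apex_hub,
    adj_rim_rim, false_and] at h
  simp only [coord, Prod.mk.injEq, and_true]
  omega

theorem ncard_commonNeighbors_rim_rim_le {s t : Fin (3 * n - 2)} (hst : s < t) :
    ((blockGraph c).commonNeighbors (rim s) (rim t)).ncard ≤ 2 := by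
  have rim_cases : ∀ r, rim r ∈ (blockGraph c).commonNeighbors (rim s) (rim t) →
      r.val = s + 1 ∧ t.val = s + 2 := fun r h => by
    simp only [mem_commonNeighbors, adj_rim_rim] at h
    omega
  have hub_cases : ∀ k, hub k ∈ (blockGraph c).commonNeighbors (rim s) (rim t) →
      k = hubOf c s ∧ s.val % 3 ≠ 1 ∧ t.val % 3 ≠ 1 := fun k h => by
    exact ⟨h.1.2.symm, h.1.1, h.2.1⟩
  by_cases ht : t.val = s + 2
  · by_cases hs : s.val % 3 = 0
    · refine ncard_le_two_of_injective coord_injective ((s : ℤ) + 1, 1) ((hubOf c s).val, 0) ?_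
      rintro (_ | r | k) h
      · simp only [mem_commonNeighbors, adj_rim_apex] at h
        omega
      · simp [coord, rim_cases r h]
      · simp [coord, hub_cases k h]
    · refine ncard_le_two_of_injective coord_injective ((s : ℤ) + 1, 1) (0, 2) ?_
      rintro (_ | r | k) h
      · exact .inr rfl
      · simp [coord, rim_cases r h]
      · have := hub_cases k h
        omega
  · refine ncard_le_two_of_injective coord_injective (0, 2) ((hubOf c s).val, 0) ?_
    rintro (_ | r | k) h
    · exact .inl rfl
    · exact absurd (rim_cases r h).2 ht
    · simp [coord, hub_cases k h]

theorem ncard_commonNeighbors_rim_hub_le (t : Fin (3 * n - 2)) (j : Fin c.length) :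
    ((blockGraph c).commonNeighbors (rim t) (hub j)).ncard ≤ 2 := by
  have rim_cases : ∀ r, rim r ∈ (blockGraph c).commonNeighbors (rim t) (hub j) →
      (r.val + 1 = t ∨ r.val = t + 1) ∧ r.val % 3 ≠ 1 := fun r h => by
    simp only [mem_commonNeighbors, adj_rim_rim, adj_hub_rim] at h
    omega
  have hub_cases : ∀ k, hub k ∈ (blockGraph c).commonNeighbors (rim t) (hub j) →
      k = hubOf c t ∧ t.val % 3 ≠ 1 := fun k h => ⟨h.1.2.symm, h.1.1⟩
  by_cases ht : t.val % 3 = 1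
  · refine ncard_le_two_of_injective coord_injective ((t : ℤ) - 1, 1) ((t : ℤ) + 1, 1) ?_
    rintro (_ | r | k) h
    · exact absurd h.2 (not_adj_hub_apex j)
    · have := rim_cases r h
      simp only [coord, Prod.mk.injEq, and_true]
      omega
    · exact absurd ht (hub_cases k h).2
  · refine ncard_le_two_of_injective coord_injective
      (if t.val % 3 = 0 then (t : ℤ) - 1 else (t : ℤ) + 1, 1) ((hubOf c t).val, 0) ?_
    rintro (_ | r | k) h
    · exact absurd h.2 (not_adj_hub_apex j)
    · have := rim_cases r h
      simp only [coord, Prod.mk.injEq, and_true]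
      split_ifs <;> omega
    · simp [coord, hub_cases k h]

theorem ncard_commonNeighbors_hub_hub_le {i j : Fin c.length} (hij : i < j) :
    ((blockGraph c).commonNeighbors (hub i) (hub j)).ncard ≤ 2 := by
  refine ncard_le_two_of_injective coord_injective ((i : ℤ) + 1, 0) ((i : ℤ) + 1, 0) ?_
  rintro (_ | r | k) h
  · exact absurd h.1 (not_adj_hub_apex i)
  · exact absurd (h.1.2.symm.trans h.2.2) hij.ne
  · simp only [mem_commonNeighbors, adj_hub_hub] at h
    simp only [coord, Prod.mk.injEq, and_true]
    omega

theorem ncard_commonNeighbors_le_two_or_mem_blocks {u v : BlockVertex c} (huv : u ≠ v) :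
    ((blockGraph c).commonNeighbors u v).ncard ≤ 2 ∨
      ((blockGraph c).commonNeighbors u v).ncard ∈ c.blocks := by
  have apex_hub : ∀ j, ((blockGraph c).commonNeighbors apex (hub j)).ncard ∈ c.blocks := fun j =>
    ncard_commonNeighbors_apex_hub j ▸ c.blocksFun_mem_blocks j
  rcases u with _ | s | i <;> rcases v with _ | t | j
  case apex.apex => exact absurd rfl huv
  case apex.rim => exact .inl (ncard_commonNeighbors_apex_rim_le t)
  case apex.hub => exact .inr (apex_hub j)
  case rim.apex => exact .inl (commonNeighbors_symm _ _ _ ▸ ncard_commonNeighbors_apex_rim_le s)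
  case rim.rim =>
    rcases lt_or_gt_of_ne (fun h => huv (congrArg rim h)) with hst | hts
    · exact .inl (ncard_commonNeighbors_rim_rim_le hst)
    · exact .inl (commonNeighbors_symm _ _ _ ▸ ncard_commonNeighbors_rim_rim_le hts)
  case rim.hub => exact .inl (ncard_commonNeighbors_rim_hub_le s j)
  case hub.apex => exact .inr (commonNeighbors_symm _ _ _ ▸ apex_hub i)
  case hub.rim => exact .inl (commonNeighbors_symm _ _ _ ▸ ncard_commonNeighbors_rim_hub_le t i)
  case hub.hub =>
    rcases lt_or_gt_of_ne (fun h => huv (congrArg hub h)) with hij | hji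
    · exact .inl (ncard_commonNeighbors_hub_hub_le hij)
    · exact .inl (commonNeighbors_symm _ _ _ ▸ ncard_commonNeighbors_hub_hub_le hji)

theorem zero_mem_commonNeighborType (hn : 2 ≤ n) : 0 ∈ (blockGraph c).commonNeighborType := by
  refine ⟨rim ⟨1, by omega⟩, rim ⟨2, by omega⟩, by simp, ?_⟩
  rw [Set.ncard_eq_zero, Set.eq_empty_iff_forall_notMem]
  rintro (_ | t | j) <;> simp only [mem_commonNeighbors, adj_rim_apex, adj_rim_rim, adj_rim_hub] <;>
    omega

theorem one_mem_commonNeighborType (hn : 3 ≤ n) : 1 ∈ (blockGraph c).commonNeighborType := by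
  refine ⟨rim ⟨1, by omega⟩, rim ⟨4, by omega⟩, by simp, Set.ncard_eq_one.2 ⟨apex, ?_⟩⟩
  ext (_ | t | j) <;> simp only [mem_commonNeighbors, Set.mem_singleton_iff, adj_rim_apex,
    adj_rim_rim, adj_rim_hub, reduceCtorEq, iff_false, iff_true] <;> omega

theorem two_mem_commonNeighborType (hn : 2 ≤ n) : 2 ∈ (blockGraph c).commonNeighborType := by
  refine ⟨apex, rim ⟨2, by omega⟩, by simp,
    Set.ncard_eq_two.2 ⟨rim ⟨1, by omega⟩, rim ⟨3, by omega⟩, by simp, ?_⟩⟩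
  ext (_ | t | j) <;> simp only [mem_commonNeighbors, Set.mem_insert_iff, Set.mem_singleton_iff,
    not_adj_apex_apex, not_adj_apex_hub, adj_apex_rim, adj_rim_rim, reduceCtorEq, rim.injEq,
    Fin.ext_iff, false_and, or_self]
  omega

theorem commonNeighborType_eq (hn : 3 ≤ n) :
    (blockGraph c).commonNeighborType = {0, 1, 2} ∪ {a | a ∈ c.blocks} := by
  apply Set.Subset.antisymm
  · rintro _ ⟨u, v, huv, rfl⟩
    refine (ncard_commonNeighbors_le_two_or_mem_blocks huv).imp_left fun hle => ?_
    simp only [Set.mem_insert_iff, Set.mem_singleton_iff]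
    omega
  · rintro a ((rfl | rfl | rfl) | ha)
    · exact zero_mem_commonNeighborType (by omega)
    · exact one_mem_commonNeighborType hn
    · exact two_mem_commonNeighborType (by omega)
    · obtain ⟨j, rfl⟩ := List.mem_iff_get.1 ha
      exact ⟨apex, hub j, by simp, ncard_commonNeighbors_apex_hub j⟩

section Connectivity

variable {S : Finset (BlockVertex c)}

theorem exists_rim_notMem_of_lt_blocksFun (j : Fin c.length) (hj : S.card < c.blocksFun j) :
    ∃ t, rim t ∉ S ∧ (blockGraph c).Adj apex (rim t) ∧ (blockGraph c).Adj (rim t) (hub j) := by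
  have hlt : (S : Set (BlockVertex c)).ncard <
      ((blockGraph c).commonNeighbors apex (hub j)).ncard := by
    rwa [Set.ncard_coe_finset, ncard_commonNeighbors_apex_hub]
  obtain ⟨w, ⟨hapex, hhub⟩, hw⟩ := Set.exists_mem_notMem_of_ncard_lt_ncard hlt S.finite_toSet
  rcases w with _ | t | k
  · exact absurd hapex (not_adj_apex_apex (c := c))
  · exact ⟨t, hw, hapex, hhub.symm⟩
  · exact absurd hapex (not_adj_apex_hub k)

theorem connected_of_apex_notMem (hS : S.card < 3) (hblocks : ∀ a ∈ c.blocks, S.card < a)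
    (hapex : apex ∉ S) : ((blockGraph c).induce {v | v ∉ S}).Connected := by
  have reach_spoke : ∀ t, t.val % 3 ≠ 2 → rim t ∉ S →
      ReachableWithin (blockGraph c) {v | v ∉ S} apex (rim t) := fun t ht hv =>
    (ReachableWithin.refl apex).step ht hv
  have reach_hub : ∀ j, hub j ∉ S →
      ReachableWithin (blockGraph c) {v | v ∉ S} apex (hub j) := fun j hv => by
    obtain ⟨t, htS, ht, htj⟩ := exists_rim_notMem_of_lt_blocksFun j
      (hblocks _ (c.blocksFun_mem_blocks j))
    exact (reach_spoke t ht htS).step htj hv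
  refine ReachableWithin.induce_connected hapex ?_
  rintro (_ | t | j) hv
  · exact .refl apex
  · by_cases ht : t.val % 3 = 2
    · -- One of the three neighbours of `rim t` survives, and each of them is reached if it does.
      rcases exists_notMem_of_card_lt_three hS (x := hub (hubOf c t))
        (y := rim ⟨t - 1, by omega⟩) (z := rim ⟨t + 1, by omega⟩)
        (by simp) (by simp) (by simp) with hhub | hprev | hnext
      · exact (reach_hub _ hhub).step (by simp [ht]) hv
      · exact (reach_spoke _ (by dsimp only; omega) hprev).step
          (Or.inl (Nat.sub_add_cancel (by omega))) hv
      · exact (reach_spoke _ (by dsimp only; omega) hnext).step (Or.inr rfl) hv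
    · exact reach_spoke t ht hv
  · exact reach_hub j hv

theorem connected_of_forall_rim_notMem (hblocks : ∀ a ∈ c.blocks, S.card < a) (hn : 0 < n)
    (hapex : apex ∈ S) (hrim : ∀ t, rim t ∉ S) :
    ((blockGraph c).induce {v | v ∉ S}).Connected := by
  have reach_rim : ∀ t, ReachableWithin (blockGraph c) {v | v ∉ S} (rim ⟨0, by omega⟩) (rim t) :=
    fun t => .of_forall_adj_succ (fun _ _ => Or.inl) hrim (Fin.le_def.2 (Nat.zero_le _))
  refine ReachableWithin.induce_connected (hrim ⟨0, by omega⟩) ?_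
  rintro (_ | t | j) hv
  · exact absurd hapex hv
  · exact reach_rim t
  · obtain ⟨t, -, -, htj⟩ := exists_rim_notMem_of_lt_blocksFun j
      (hblocks _ (c.blocksFun_mem_blocks j))
    exact (reach_rim t).step htj hv

theorem connected_of_forall_hub_notMem (hS : S.card < 3) (hn : 0 < n)
    (hapex : apex ∈ S) (hhub : ∀ j, hub j ∉ S) :
    ((blockGraph c).induce {v | v ∉ S}).Connected := by
  have hlength : 0 < c.length := c.length_pos_iff.2 hn
  have reach_hub : ∀ j, ReachableWithin (blockGraph c) {v | v ∉ S} (hub ⟨0, hlength⟩) (hub j) :=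
    fun j => .of_forall_adj_succ (fun _ _ => Or.inl) hhub (Fin.le_def.2 (Nat.zero_le _))
  have reach_spoke : ∀ t, t.val % 3 ≠ 1 → rim t ∉ S →
      ReachableWithin (blockGraph c) {v | v ∉ S} (hub ⟨0, hlength⟩) (rim t) := fun t ht hv =>
    (reach_hub (hubOf c t)).step ⟨ht, rfl⟩ hv
  refine ReachableWithin.induce_connected (hhub ⟨0, hlength⟩) ?_
  rintro (_ | t | j) hv
  · exact absurd hapex hv
  · by_cases ht : t.val % 3 = 1
    · rcases exists_notMem_of_card_lt_three hS (x := apex)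
        (y := rim ⟨t - 1, by omega⟩) (z := rim ⟨t + 1, by omega⟩)
        (by simp) (by simp) (by simp) with h | hprev | hnext
      · exact absurd hapex h
      · exact (reach_spoke _ (by dsimp only; omega) hprev).step
          (Or.inl (Nat.sub_add_cancel (by omega))) hv
      · exact (reach_spoke _ (by dsimp only; omega) hnext).step (Or.inr rfl) hv
    · exact reach_spoke t ht hv
  · exact reach_hub j

theorem isVertexConnected_three (hn : 0 < n) (hblocks : ∀ a ∈ c.blocks, 3 ≤ a) :
    (blockGraph c).IsVertexConnected 3 := by
  have hlength : 0 < c.length := c.length_pos_iff.2 hn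
  have hn3 : 3 ≤ n := (hblocks _ (c.blocksFun_mem_blocks ⟨0, hlength⟩)).trans (c.blocksFun_le _)
  refine ⟨by rw [card_eq]; omega, fun S hS => ?_⟩
  have hlt : ∀ a ∈ c.blocks, S.card < a := fun a ha => hS.trans_le (hblocks a ha)
  by_cases hapex : apex ∈ S
  · by_cases hhub : ∃ j, hub j ∈ S
    · obtain ⟨j, hj⟩ := hhub
      refine connected_of_forall_rim_notMem hlt hn hapex fun t => ?_
      exact ((exists_notMem_of_card_lt_three hS (x := apex) (y := hub j) (z := rim t)
        (by simp) (by simp) (by simp)).resolve_left (not_not_intro hapex)).resolve_left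
          (not_not_intro hj)
    · push Not at hhub
      exact connected_of_forall_hub_notMem hS hn hapex hhub
  · exact connected_of_apex_notMem hS hlt hapex

end Connectivity

theorem isPolyhedron (hn : 0 < n) (hblocks : ∀ a ∈ c.blocks, 3 ≤ a) :
    (blockGraph c).IsPolyhedron :=
  ⟨(layeredDrawing c).isPlanar, isVertexConnected_three hn hblocks⟩

end blockGraph

/-- The composition whose blocks are the elements of `A` followed by `k` further copies of `a`.
Varying `k` gives block graphs of different orders with the same block sizes. -/
noncomputable def paddedComposition {A : Finset ℕ} {a : ℕ} (hA : ∀ x ∈ A, 0 < x) (ha : a ∈ A)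
    (k : ℕ) : Composition (∑ x ∈ A, x + k * a) where
  blocks := A.toList ++ List.replicate k a
  blocks_pos hx := by
    rcases List.mem_append.1 hx with hx | hx
    · exact hA _ (Finset.mem_toList.1 hx)
    · exact List.eq_of_mem_replicate hx ▸ hA a ha
  blocks_sum := by simp

namespace paddedComposition

variable {A : Finset ℕ} {a : ℕ} {hA : ∀ x ∈ A, 0 < x} {ha : a ∈ A}

theorem mem_blocks {k x : ℕ} : x ∈ (paddedComposition hA ha k).blocks ↔ x ∈ A := by
  simp only [paddedComposition, List.mem_append, Finset.mem_toList, or_iff_left_iff_imp]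
  exact fun hx => List.eq_of_mem_replicate hx ▸ ha

theorem length_eq (k : ℕ) : (paddedComposition hA ha k).length = A.card + k := by
  simp [paddedComposition, Composition.length]

theorem strictMono_card_blockVertex :
    StrictMono fun k => Fintype.card (BlockVertex (paddedComposition hA ha k)) := by
  intro k l hkl
  have hmul : k * a ≤ l * a := Nat.mul_le_mul_right a hkl.le
  simp only [card_eq, length_eq]
  omega

end paddedComposition

theorem mainTheorem12 (A' : Finset ℕ) (hne : A'.Nonempty) (hA' : ∀ a ∈ A', 3 ≤ a) :
    ∃ (n : ℕ → ℕ) (G : (k : ℕ) → SimpleGraph (Fin (n k))),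
      (∀ k : ℕ, (G k).IsPolyhedron ∧ (G k).commonNeighborType = {0, 1, 2} ∪ (A' : Set ℕ)) ∧
      ∀ k l : ℕ, k ≠ l → IsEmpty (G k ≃g G l) := by
  obtain ⟨a, ha⟩ := hne
  have hpos : ∀ x ∈ A', 0 < x := fun x hx => zero_lt_three.trans_le (hA' x hx)
  let c (k : ℕ) := paddedComposition hpos ha k
  have hblocks (k : ℕ) : ∀ x ∈ (c k).blocks, 3 ≤ x := fun x hx =>
    hA' x (paddedComposition.mem_blocks.1 hx)
  have hn (k : ℕ) : 3 ≤ ∑ x ∈ A', x + k * a :=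
    (hA' a ha).trans ((c k).blocks_le (paddedComposition.mem_blocks.2 ha))
  let φ (k : ℕ) := (blockGraph (c k)).overFinIso rfl
  refine ⟨_, fun k => (blockGraph (c k)).overFin rfl, fun k => ⟨?polyhedron, ?type⟩, ?noniso⟩
  case polyhedron =>
    exact isPolyhedron_of_iso (φ k)
      (blockGraph.isPolyhedron (zero_lt_three.trans_le (hn k)) (hblocks k))
  case type =>
    rw [← commonNeighborType_eq_of_iso (φ k), blockGraph.commonNeighborType_eq (hn k)]
    exact congrArg _ (Set.ext fun _ => paddedComposition.mem_blocks)
  case noniso =>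
    refine fun k l hkl => ⟨fun e => hkl ?_⟩
    have hcard := Fintype.card_congr e.toEquiv
    rw [Fintype.card_fin, Fintype.card_fin] at hcard
    exact paddedComposition.strictMono_card_blockVertex.injective hcard
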